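/- **Theorem (Existence and uniqueness of the Nash equilibrium of the caching game).** Let $\mathcal C$ be a finite set of content providers (the players), each with $M\ge 1$ content classes. Let $\Lambda,r,N>0$ (density of small cells, covering radius, number of caching slots), let $N_c^i>0$ and $g_c^i>0$ be the number of contents and the demand rate of class $i$ of player $c$, and put $\Lambda_c^i:=\pi r^2\Lambda N/N_c^i$. Let $\delta>0$ (reservation of the network provider) and, for every $c\in\mathcal C$, let $B_c\ge 0$ (maximum caching rate) and $\lambda_c\ge 0$ (price). Write $\Pi=\{u\in\mathbb R^M: u^i\ge 0,\ \sum_i u^i=1\}$ for the set of caching policies. The strategy of player $c$ is his caching rate $b_c\in[0,B_c]$. At the profile $\mathbf b=(b_v)_{v\in\mathcal C}$ he occupies the share $x_c(\mathbf b)=b_c/\big(\sum_{v\in\mathcal C} b_v+\delta\big)$ of the cache and minimizes, in $b_c$, the cost $$J_c(\mathbf b)=V_c\big(x_c(\mathbf b)\big)+\lambda_c\,b_c .$$ Each player is of one of the following two kinds, and both kinds may be present in the same game: * a *caching-rate optimizer*, with a fixed caching policy $u_c\in\Pi$ and $V_c(x)=\sum_{i=1}^M g_c^i\,e^{-\Lambda_c^i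 x u_c^i}$; * a *simultaneous optimizer*, with $V_c(x)=\min_{u\in\Pi}\sum_{i=1}^M g_c^i\,e^{-\Lambda_c^i x u^i}$. (Thus the game is a generalized Kelly mechanism with reservation $\delta$, bounded strategy sets and player-dependent prices.) Then this game has exactly one Nash equilibrium, that is, there is exactly one profile $\mathbf b^*$ with $b_c^*\in[0,B_c]$ for all $c$ such that $J_c(\mathbf b^*)\le J_c(y,\mathbf b^*_{-c})$ for all $c\in\mathcal C$ and all $y\in[0,B_c]$, where $(y,\mathbf b^*_{-c})$ is $\mathbf b^*$ with its $c$-th entry replaced by $y$. -/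

import Mathlib

/-- The behaviour of a content provider whose contents fall into `M` classes. -/
inductive ProviderKind (M : ℕ) where
  /-- A caching-rate optimizer: optimizes his caching rate for a caching policy `u`, a point of
  the simplex, that is fixed beforehand. -/
  | rateOptimizer (u : stdSimplex ℝ (Fin M)) : ProviderKind M
  /-- A simultaneous optimizer: for every caching rate he uses an optimal caching policy. -/
  | simultaneousOptimizer : ProviderKind M

/-- The data of a caching game with set of content providers `C` and `M` content classes. -/
structure CachingGame (C : Type*) (M : ℕ) where
  /-- There is at least one content class. -/
  classes_pos : 0 < M
  /-- Spatial density of the small cells. -/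
  intensity : ℝ
  intensity_pos : 0 < intensity
  /-- Covering radius of the users. -/
  radius : ℝ
  radius_pos : 0 < radius
  /-- Number of caching slots of a local edge cache unit. -/
  slots : ℝ
  slots_pos : 0 < slots
  /-- Number of contents in each class of each provider. -/
  contents : C → Fin M → ℝ
  contents_pos : ∀ c i, 0 < contents c i
  /-- Popularity (demand rate) of each class of each provider. -/
  popularity : C → Fin M → ℝ
  popularity_pos : ∀ c i, 0 < popularity c i
  /-- The caching rate that the network provider reserves for herself. -/
  reserved : ℝ
  reserved_pos : 0 < reserved
  /-- Maximum caching rate of each provider. -/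
  maxRate : C → ℝ
  maxRate_nonneg : ∀ c, 0 ≤ maxRate c
  /-- Price per unit of caching rate for each provider. -/
  price : C → ℝ
  price_nonneg : ∀ c, 0 ≤ price c
  /-- Which kind of optimizer each provider is. -/
  kind : C → ProviderKind M

namespace CachingGame

/-- The availability of the contents of class `i` of provider `c`. -/
noncomputable def availability {C : Type*} {M : ℕ} (G : CachingGame C M) (c : C) (i : Fin M) : ℝ :=
  Real.pi * G.radius ^ 2 * G.intensity * G.slots / G.contents c i

/-- The share of cache memory occupied by provider `c` at the profile of caching rates `b`. -/
noncomputable def share {C : Type*} [Fintype C] {M : ℕ} (G : CachingGame C M)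
    (b : C → ℝ) (c : C) : ℝ :=
  b c / (∑ v, b v + G.reserved)

/-- The expected missed cache rate of provider `c` under the caching policy `u`, when he occupies
the share `x` of the cache memory. -/
noncomputable def missedRate {C : Type*} {M : ℕ} (G : CachingGame C M) (c : C)
    (u : stdSimplex ℝ (Fin M)) (x : ℝ) : ℝ :=
  ∑ i, G.popularity c i * Real.exp (-(G.availability c i * x * u.1 i))

/-- The optimal missed cache rate of provider `c`, minimized over all caching policies (the
infimum is attained, see `exists_optimal_policy`). -/
noncomputable def optimalMissedRate {C : Type*} {M : ℕ} (G : CachingGame C M) (c : C)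
    (x : ℝ) : ℝ :=
  ⨅ u : stdSimplex ℝ (Fin M), G.missedRate c u x

/-- The minimum that defines the optimal missed cache rate exists. -/
theorem exists_optimal_policy {C : Type*} {M : ℕ} (G : CachingGame C M) (c : C) (x : ℝ) :
    ∃ u : stdSimplex ℝ (Fin M), G.optimalMissedRate c x = G.missedRate c u x ∧
      ∀ v : stdSimplex ℝ (Fin M), G.missedRate c u x ≤ G.missedRate c v x := by
  have hne : Nonempty (stdSimplex ℝ (Fin M)) :=
    ⟨⟨_, single_mem_stdSimplex ℝ (⟨0, G.classes_pos⟩ : Fin M)⟩⟩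
  have hcpt : CompactSpace (stdSimplex ℝ (Fin M)) :=
    isCompact_iff_compactSpace.mp (isCompact_stdSimplex ℝ (Fin M))
  have hcont : Continuous (fun u : stdSimplex ℝ (Fin M) => G.missedRate c u x) := by
    unfold missedRate
    refine continuous_finsetSum _ fun i _ => ?_
    have hi : Continuous (fun u : stdSimplex ℝ (Fin M) => u.1 i) :=
      (continuous_apply i).comp continuous_subtype_val
    exact continuous_const.mul (Real.continuous_exp.comp (continuous_const.mul hi).neg)
  obtain ⟨u, -, hu⟩ := isCompact_univ.exists_isMinOn Set.univ_nonempty hcont.continuousOn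
  have hmin : ∀ v, G.missedRate c u x ≤ G.missedRate c v x := fun v => hu (Set.mem_univ v)
  refine ⟨u, le_antisymm (ciInf_le ⟨G.missedRate c u x, ?_⟩ u) (le_ciInf hmin), hmin⟩
  rintro _ ⟨v, rfl⟩
  exact hmin v

/-- The missed cache rate that enters the cost of provider `c`, according to his kind. -/
noncomputable def effectiveMissedRate {C : Type*} {M : ℕ} (G : CachingGame C M) (c : C)
    (x : ℝ) : ℝ :=
  match G.kind c with
  | .rateOptimizer u => G.missedRate c u x
  | .simultaneousOptimizer => G.optimalMissedRate c x

/-- The cost of provider `c` at the profile of caching rates `b`. -/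
noncomputable def cost {C : Type*} [Fintype C] {M : ℕ} (G : CachingGame C M)
    (c : C) (b : C → ℝ) : ℝ :=
  G.effectiveMissedRate c (G.share b c) + G.price c * b c

/-- A Nash equilibrium: a feasible profile of caching rates at which no provider can lower his
cost by a feasible unilateral change of his own caching rate. -/
def IsNashEquilibrium {C : Type*} [Fintype C] [DecidableEq C] {M : ℕ} (G : CachingGame C M)
    (b : C → ℝ) : Prop :=
  (∀ c, b c ∈ Set.Icc 0 (G.maxRate c)) ∧
    ∀ c, ∀ y ∈ Set.Icc 0 (G.maxRate c), G.cost c b ≤ G.cost c (Function.update b c y)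

end CachingGame

/-! On the nonnegative half-line each `V_c` is convex with slope `-f`, where `f` is continuous and
positive. A best response depends on the rivals only through the total rate `S` (reservation
included): it amounts to sign conditions on `p * S - f x * (1 - x)` at the share `x`
(`bestResponse_iff_isStationaryShare`). As `f x * (1 - x)` strictly decreases on `[0, 1]`, `S`
determines `x`, and `x` does not increase with `S` (`IsStationaryShare.anti`). Equilibrium shares
sum to `1 - δ / S`, which strictly increases, so only one `S` is possible. Existence is thus
one-dimensional: the stationary shares are continuous in `S`, and the intermediate value theorem
finds an `S` equal to the total it induces. For simultaneous optimizers, `f` is the water-filling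
multiplier. -/

/-- `f` is a continuous positive marginal decrease of `V` on the nonnegative half-line: `-f x` is
a subgradient of `V` at every `x ≥ 0`. -/
structure IsMarginalDecrease (V f : ℝ → ℝ) : Prop where
  continuous : Continuous f
  pos : ∀ x, 0 < f x
  subgradient : ∀ x y, 0 ≤ x → 0 ≤ y → V x - f x * (y - x) ≤ V y

namespace IsMarginalDecrease

variable {V f : ℝ → ℝ}

theorem antitone (h : IsMarginalDecrease V f) {x y : ℝ} (hx : 0 ≤ x) (hxy : x < y) :
    f y ≤ f x := by
  have h1 := h.subgradient x y hx (hx.trans hxy.le)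
  have h2 := h.subgradient y x (hx.trans hxy.le) hx
  by_contra! hlt
  nlinarith [mul_pos (sub_pos.2 hlt) (sub_pos.2 hxy)]

theorem mul_one_sub_lt (h : IsMarginalDecrease V f) {x y : ℝ} (hx : 0 ≤ x) (hxy : x < y)
    (hy : y ≤ 1) : f y * (1 - y) < f x * (1 - x) := by
  have h1 := h.antitone hx hxy
  have h2 := h.pos x
  nlinarith [mul_nonneg (sub_nonneg.2 h1) (sub_nonneg.2 hy), mul_pos h2 (sub_pos.2 hxy)]

end IsMarginalDecrease

/-! ### Stationary shares as functions of the total rate -/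

/-- The share `x` satisfies the first-order optimality conditions of a player with marginal
decrease `f`, price `p` and maximum rate `B` when the total rate is `S`. -/
structure IsStationaryShare (f : ℝ → ℝ) (p B S x : ℝ) : Prop where
  nonneg : 0 ≤ x
  le_one : x ≤ 1
  mul_le : x * S ≤ B
  variational : ∀ y ∈ Set.Icc 0 B, 0 ≤ (p * S - f x * (1 - x)) * (y - x * S)

/-- If the share grew with the total, the larger share, being positive, would give `p * S' ≤ f x' *
(1 - x')`. Then the marginal gain at `x` strictly exceeds `p * S`, which forces the cap `x * S = B`;
but `x * S < x' * S' ≤ B`. -/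
theorem IsStationaryShare.anti {V f : ℝ → ℝ} (h : IsMarginalDecrease V f) {p B S S' x x' : ℝ}
    (hp : 0 ≤ p) (hS : 0 < S) (hSS' : S ≤ S') (hx : IsStationaryShare f p B S x)
    (hx' : IsStationaryShare f p B S' x') : x' ≤ x := by
  by_contra! hlt
  have hB : 0 ≤ B := (mul_nonneg hx.nonneg hS.le).trans hx.mul_le
  have hφ := h.mul_one_sub_lt hx.nonneg hlt hx'.le_one
  have h0 := hx'.variational 0 ⟨le_rfl, hB⟩
  have h1 := hx.variational B ⟨hB, le_rfl⟩
  have hx'S : 0 < x' * S' := mul_pos (hx.nonneg.trans_lt hlt) (hS.trans_le hSS')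
  have h2 : p * S' - f x' * (1 - x') ≤ 0 := by
    by_contra! hc
    nlinarith [mul_pos hc hx'S]
  have h3 : p * S ≤ p * S' := mul_le_mul_of_nonneg_left hSS' hp
  have h4 : B - x * S ≤ 0 := by
    by_contra! hc
    nlinarith [mul_pos hc (show 0 < f x * (1 - x) - p * S by linarith)]
  have h5 : x * S ≤ x * S' := mul_le_mul_of_nonneg_left hSS' hx.nonneg
  have h6 : x * S' < x' * S' := mul_lt_mul_of_pos_right hlt (hS.trans_le hSS')
  linarith [hx'.mul_le]

/-- The stationary share depends continuously on the total rate. -/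
theorem exists_continuousOn_stationaryShare {V f : ℝ → ℝ} (h : IsMarginalDecrease V f) {p B : ℝ}
    (hp : 0 ≤ p) (hB : 0 ≤ B) :
    ∃ X : ℝ → ℝ, ContinuousOn X (Set.Ioi 0) ∧ ∀ S, 0 < S → IsStationaryShare f p B S (X S) := by
  have hf := h.continuous
  let k : ℝ → ℝ := fun x => max 0 (min x 1)
  have hk : Continuous k := by fun_prop
  have hk0 : ∀ x, 0 ≤ k x := fun x => le_max_left _ _
  have hk1 : ∀ x, k x ≤ 1 := fun x => max_le zero_le_one (min_le_right _ _)
  have hkid : ∀ x, 0 ≤ x → x ≤ 1 → k x = x := fun x h0 h1 => by simp [k, h0, h1]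
  -- Extends `-f x * (1 - x)` from `[0, 1]` to the line with slope one, giving an increasing
  -- bijection whose inverse is continuous.
  let ψ : ℝ → ℝ := fun x => (x - k x) - f (k x) * (1 - k x)
  have hψc : Continuous ψ := by fun_prop
  have hψ : StrictMono ψ := by
    intro x y hxy
    have hkm : k x ≤ k y := max_le_max le_rfl (min_le_min hxy.le le_rfl)
    have hks : k y - k x ≤ y - x := by
      simp only [k]
      rcases le_total 0 (min x 1) with h1 | h1 <;> rcases le_total 0 (min y 1) with h2 | h2 <;>
        rcases le_total x 1 with h3 | h3 <;> rcases le_total y 1 with h4 | h4 <;>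
        simp_all <;> linarith
    rcases hkm.eq_or_lt with he | hlt
    · simp only [ψ, ← he]; linarith
    · have := h.mul_one_sub_lt (hk0 x) hlt (hk1 y)
      simp only [ψ]; linarith
  have hφ0 : ∀ x, 0 ≤ f (k x) * (1 - k x) := fun x =>
    mul_nonneg (h.pos _).le (sub_nonneg.2 (hk1 x))
  have hφ1 : ∀ x, f (k x) * (1 - k x) ≤ f 0 := fun x => by
    have h1 : f (k x) ≤ f 0 := by
      rcases (hk0 x).eq_or_lt with he | hlt
      · rw [← he]
      · exact h.antitone le_rfl hlt
    nlinarith [h.pos (k x), hk0 x]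
  have hsurj : Function.Surjective ψ := by
    refine hψc.surjective ?_ ?_
    · refine Filter.tendsto_atTop_mono (f := fun x => x + (-1 - f 0)) (fun x => ?_)
        (Filter.tendsto_atTop_add_const_right _ _ Filter.tendsto_id)
      simp only [ψ]; linarith [hφ1 x, hk1 x]
    · refine Filter.tendsto_atBot_mono (f := fun x : ℝ => x) (fun x => ?_) Filter.tendsto_id
      simp only [ψ]; linarith [hφ0 x, hk0 x]
  let e : ℝ ≃o ℝ := hψ.orderIsoOfSurjective ψ hsurj
  have he : ∀ z, ψ (e.symm z) = z := fun z => e.apply_symm_apply z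
  have hec : Continuous e.symm := e.symm.continuous
  -- The root of `f x * (1 - x) = p * S`, clipped to `[0, B / S]`. No clipping at `1` is needed,
  -- because `ψ 1 = 0 ≥ -(p * S)`.
  refine ⟨fun S => min (max 0 (e.symm (-(p * S)))) (B / S), ?_, fun S hS => ?_⟩
  · refine ContinuousOn.inf (Continuous.continuousOn (by fun_prop)) ?_
    exact continuousOn_const.div continuousOn_id fun S hS => ne_of_gt hS
  · beta_reduce
    have hpS : 0 ≤ p * S := mul_nonneg hp hS.le
    set z := e.symm (-(p * S)) with hz
    have hψz : ψ z = -(p * S) := he _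
    have hz1 : z ≤ 1 := by
      by_contra! hc
      have := hψ hc
      have h1 : ψ 1 = 0 := by simp [ψ, hkid 1 zero_le_one le_rfl]
      linarith
    have hBS : 0 ≤ B / S := div_nonneg hB hS.le
    set x := min (max 0 z) (B / S) with hx
    have hx0 : 0 ≤ x := le_min (le_max_left _ _) hBS
    have hx1 : x ≤ 1 := (min_le_left _ _).trans (max_le zero_le_one hz1)
    have hψx : ψ x = - (f x * (1 - x)) := by simp [ψ, hkid x hx0 hx1]
    refine ⟨hx0, hx1, (le_div_iff₀ hS).1 (min_le_right _ _), fun y hy => ?_⟩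
    rw [show p * S - f x * (1 - x) = ψ x - ψ z by rw [hψx, hψz]; ring]
    rcases lt_trichotomy x z with hlt | heq | hgt
    · have hxB : x = B / S := by
        refine (min_choice (max 0 z) (B / S)).resolve_left fun hc => ?_
        exact absurd (le_max_right 0 z) (not_le.2 (by rw [← hc]; exact hlt))
      have : x * S = B := by rw [hxB]; field_simp
      exact mul_nonneg_of_nonpos_of_nonpos (sub_nonpos.2 (hψ hlt).le) (by linarith [hy.2])
    · simp [heq]
    · have hxz : x = 0 := by
        refine le_antisymm ?_ hx0
        by_contra! hc
        have h1 : x ≤ max 0 z := min_le_left _ _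
        exact absurd h1 (not_le.2 (max_lt hc hgt))
      refine mul_nonneg (sub_nonneg.2 (hψ hgt).le) ?_
      rw [hxz]; linarith [hy.1]

/-! ### Best responses in a Kelly mechanism -/

theorem share_sub_share {b y s : ℝ} (hs : 0 < s) (hb : 0 ≤ b) (hy : 0 ≤ y) :
    y / (y + s) - b / (b + s) = (y - b) * (1 - b / (b + s)) / (y + s) := by
  have : b + s ≠ 0 := by positivity
  have : y + s ≠ 0 := by positivity
  field_simp
  ring

/-- In a Kelly mechanism, the best responses of a player are characterized by the first-order
conditions. -/
theorem bestResponse_iff_isStationaryShare {V f : ℝ → ℝ} (h : IsMarginalDecrease V f)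
    {p B s b : ℝ} (hs : 0 < s) (hb : b ∈ Set.Icc 0 B) :
    (∀ y ∈ Set.Icc 0 B, V (b / (b + s)) + p * b ≤ V (y / (y + s)) + p * y) ↔
      IsStationaryShare f p B (b + s) (b / (b + s)) := by
  have hS : 0 < b + s := by linarith [hb.1]
  have hbS : b / (b + s) * (b + s) = b := div_mul_cancel₀ _ hS.ne'
  have hx0 : 0 ≤ b / (b + s) := div_nonneg hb.1 hS.le
  have hx1 : b / (b + s) ≤ 1 := (div_le_one hS).2 (by linarith)
  constructor
  · intro hbest
    refine ⟨hx0, hx1, hbS.le.trans hb.2, fun y hy => ?_⟩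
    rw [hbS]
    -- The subgradient is taken at the perturbed point, where it bounds the change of `V` from
    -- above; continuity of `f` then allows `t → 0` without differentiating `V`.
    have key : ∀ t ∈ Set.Ioo (0 : ℝ) 1, 0 ≤ (y - b) * (p - f ((b + t * (y - b)) /
        (b + t * (y - b) + s)) * (1 - b / (b + s)) / (b + t * (y - b) + s)) := by
      intro t ht
      set z := b + t * (y - b) with hz
      have hz0 : 0 ≤ z := by
        linarith [mul_nonneg ht.1.le hy.1, mul_nonneg (sub_nonneg.2 ht.2.le) hb.1]
      have hzB : z ≤ B := by
        nlinarith [mul_nonneg ht.1.le (sub_nonneg.2 hy.2),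
          mul_nonneg (sub_nonneg.2 ht.2.le) (sub_nonneg.2 hb.2)]
      have h1 := hbest z ⟨hz0, hzB⟩
      have h2 := h.subgradient (z / (z + s)) (b / (b + s)) (by positivity) hx0
      have h3 := share_sub_share hs hb.1 hz0
      have h4 : 0 ≤ t * ((y - b) * (p - f (z / (z + s)) * (1 - b / (b + s)) / (z + s))) := by
        have h5 : t * ((y - b) * (p - f (z / (z + s)) * (1 - b / (b + s)) / (z + s))) =
            p * (z - b) - f (z / (z + s)) * (z / (z + s) - b / (b + s)) := by
          rw [h3, hz]; ring
        rw [h5]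
        linarith
      exact nonneg_of_mul_nonneg_right h4 ht.1
    have hlim : Filter.Tendsto (fun t : ℝ => (y - b) * (p - f ((b + t * (y - b)) /
        (b + t * (y - b) + s)) * (1 - b / (b + s)) / (b + t * (y - b) + s)))
        (nhdsWithin 0 (Set.Ioi 0))
        (nhds ((y - b) * (p - f (b / (b + s)) * (1 - b / (b + s)) / (b + s)))) := by
      have hc : ContinuousAt (fun t : ℝ => (y - b) * (p - f ((b + t * (y - b)) /
          (b + t * (y - b) + s)) * (1 - b / (b + s)) / (b + t * (y - b) + s))) 0 := by
        have hne : b + 0 * (y - b) + s ≠ 0 := by simpa using hS.ne'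
        have hf := h.continuous
        have h1 : ContinuousAt (fun t : ℝ => b + t * (y - b) + s) 0 := by fun_prop
        have h2 : ContinuousAt (fun t : ℝ => (b + t * (y - b)) / (b + t * (y - b) + s)) 0 :=
          ContinuousAt.div (by fun_prop) h1 hne
        exact continuousAt_const.mul (continuousAt_const.sub
          (((hf.continuousAt.comp h2).mul continuousAt_const).div h1 hne))
      have := hc.tendsto
      simp only [zero_mul, add_zero] at this
      exact this.mono_left nhdsWithin_le_nhds
    have h0 := ge_of_tendsto hlim (Filter.mem_of_superset (Ioo_mem_nhdsGT one_pos) key)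
    have h1 := mul_nonneg hS.le h0
    have h2 : (b + s) * ((y - b) * (p - f (b / (b + s)) * (1 - b / (b + s)) / (b + s))) =
        (p * (b + s) - f (b / (b + s)) * (1 - b / (b + s))) * (y - b) := by
      generalize f (b / (b + s)) * (1 - b / (b + s)) = a
      field_simp
    rwa [h2] at h1
  · intro hst y hy
    have hy0 := hy.1
    have h1 := hst.variational y hy
    rw [hbS] at h1
    have h2 := h.subgradient (b / (b + s)) (y / (y + s)) hx0 (by positivity)
    rw [share_sub_share hs hb.1 hy.1] at h2
    have hys : 0 < y + s := by positivity
    have ha : 0 ≤ f (b / (b + s)) * (1 - b / (b + s)) :=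
      mul_nonneg (h.pos _).le (sub_nonneg.2 hx1)
    have h3 : f (b / (b + s)) * ((y - b) * (1 - b / (b + s)) / (y + s)) =
        (f (b / (b + s)) * (1 - b / (b + s))) * (y - b) / (y + s) := by ring
    rw [h3] at h2
    generalize f (b / (b + s)) * (1 - b / (b + s)) = a at *
    -- Stationarity compares `a` with `p * (b + s)`; replacing `b + s` by `y + s` preserves the
    -- inequality in either direction, as `a ≥ 0`.
    have h4 : a * (y - b) / (y + s) ≤ p * (y - b) := by
      rw [div_le_iff₀ hys]
      rcases le_total b y with hby | hby
      · rcases hby.eq_or_lt with rfl | hlt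
        · simp
        · have : 0 ≤ p * (b + s) - a := nonneg_of_mul_nonneg_left h1 (sub_pos.2 hlt)
          have hp : 0 ≤ p := by
            by_contra! hc
            nlinarith
          nlinarith [mul_nonneg this (sub_pos.2 hlt).le, mul_nonneg hp (sq_nonneg (y - b))]
      · rcases hby.eq_or_lt with rfl | hlt
        · simp
        · have h5 : p * (b + s) - a ≤ 0 := by
            by_contra! hc
            nlinarith [mul_pos hc (sub_pos.2 hlt)]
          have h6 : p * (y + s) ≤ a := by
            rcases le_total 0 p with hp | hp
            · nlinarith
            · nlinarith
          nlinarith [mul_nonneg (sub_nonneg.2 h6) (sub_pos.2 hlt).le]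
    linarith

/-! ### Marginal decreases of the missed cache rates -/

theorem exp_subgradient {g a v w : ℝ} (hg : 0 ≤ g) :
    g * Real.exp (-(a * v)) - g * a * Real.exp (-(a * v)) * (w - v) ≤ g * Real.exp (-(a * w)) := by
  have h1 := Real.add_one_le_exp (-(a * (w - v)))
  have h2 : Real.exp (-(a * w)) = Real.exp (-(a * v)) * Real.exp (-(a * (w - v))) := by
    rw [← Real.exp_add]; ring_nf
  rw [h2]
  have h3 := mul_le_mul_of_nonneg_left h1 (mul_nonneg hg (Real.exp_pos (-(a * v))).le)
  nlinarith

namespace CachingGame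

variable {C : Type*} {M : ℕ} (G : CachingGame C M)

theorem availability_pos (c : C) (i : Fin M) : 0 < G.availability c i := by
  have := G.radius_pos
  have := G.intensity_pos
  have := G.slots_pos
  have := G.contents_pos c i
  unfold availability
  positivity

theorem isMarginalDecrease_missedRate (c : C) (u : stdSimplex ℝ (Fin M)) :
    IsMarginalDecrease (G.missedRate c u) fun x =>
      ∑ i, G.popularity c i * (G.availability c i * u.1 i) *
        Real.exp (-(G.availability c i * u.1 i * x)) where
  continuous := by fun_prop
  pos x := by
    have hg := G.popularity_pos c
    have ha := G.availability_pos c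
    obtain ⟨i, -, hi⟩ : ∃ i ∈ Finset.univ, 0 < u.1 i :=
      (Finset.sum_pos_iff_of_nonneg fun i _ => u.2.1 i).1 (by rw [u.2.2]; exact one_pos)
    refine Finset.sum_pos' (fun i _ => ?_) ⟨i, Finset.mem_univ i, ?_⟩
    · exact mul_nonneg (mul_nonneg (hg i).le (mul_nonneg (ha i).le (u.2.1 i)))
        (Real.exp_pos _).le
    · exact mul_pos (mul_pos (hg i) (mul_pos (ha i) hi)) (Real.exp_pos _)
  subgradient x y _ _ := by
    unfold missedRate
    rw [Finset.sum_mul, ← Finset.sum_sub_distrib]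
    refine Finset.sum_le_sum fun i _ => ?_
    have := exp_subgradient (a := G.availability c i * u.1 i) (v := x) (w := y)
      (G.popularity_pos c i).le
    rwa [mul_right_comm _ x, mul_right_comm _ y]

/-- Water-filling: for suitable thresholds, the optimal allocation equalizes the marginal
decreases of the classes that are cached. -/
theorem exists_waterFilling [Nonempty (Fin M)] (l a : Fin M → ℝ) (ha : ∀ i, 0 < a i) :
    ∃ σ : ℝ → ℝ, Continuous σ ∧ ∀ x, 0 ≤ x → ∑ i, max 0 ((l i + σ x) / a i) = x := by
  obtain ⟨j, hj⟩ := Finite.exists_max l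
  let T : ℝ → ℝ := fun s => ∑ i, max 0 ((l i + s) / a i)
  have hT0 : ∀ s, l j + s ≤ 0 → T s = 0 := fun s hs => by
    refine Finset.sum_eq_zero fun i _ => max_eq_left ?_
    exact div_nonpos_of_nonpos_of_nonneg (by linarith [hj i]) (ha i).le
  have hTmono : Monotone T := fun s t hst => Finset.sum_le_sum fun i _ =>
    max_le_max le_rfl (div_le_div_of_nonneg_right (by linarith) (ha i).le)
  have hTj : ∀ s, (l j + s) / a j ≤ T s := fun s =>
    (le_max_right 0 _).trans (Finset.single_le_sum
      (f := fun i => max 0 ((l i + s) / a i)) (fun i _ => le_max_left _ _) (Finset.mem_univ j))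
  have hTstrict : ∀ s t, 0 < l j + t → s < t → T s < T t := fun s t ht hst => by
    refine Finset.sum_lt_sum (fun i _ => max_le_max le_rfl
      (div_le_div_of_nonneg_right (by linarith) (ha i).le)) ⟨j, Finset.mem_univ j, ?_⟩
    rw [max_eq_right (div_pos ht (ha j)).le]
    exact max_lt (div_pos ht (ha j)) (div_lt_div_of_pos_right (by linarith) (ha j))
  -- `T` vanishes until the class `j` with the largest `l` starts to fill. The added term makes the
  -- map invertible there and is zero wherever `R` is nonnegative.
  let R : ℝ → ℝ := fun s => T s + min 0 (l j + s)
  have hR : StrictMono R := fun s t hst => by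
    rcases le_or_gt (l j + t) 0 with ht | ht
    · simp only [R, hT0 t ht, hT0 s (by linarith), min_eq_right ht,
        min_eq_right (show l j + s ≤ 0 by linarith)]
      linarith
    · exact add_lt_add_of_lt_of_le (hTstrict s t ht hst) (min_le_min le_rfl (by linarith))
  have hRc : Continuous R := by fun_prop
  have hsurj : Function.Surjective R := by
    refine hRc.surjective ?_ ?_
    · have h1 : Filter.Tendsto (fun s => (l j + s) / a j) Filter.atTop Filter.atTop :=
        (Filter.tendsto_atTop_add_const_left _ _ Filter.tendsto_id).atTop_div_const (ha j)
      refine Filter.tendsto_atTop_mono' _ ?_ h1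
      filter_upwards [Filter.eventually_ge_atTop (-l j)] with s hs
      simp only [R, min_eq_left (show 0 ≤ l j + s by linarith)]
      linarith [hTj s]
    · have h1 : Filter.Tendsto (fun s => l j + s) Filter.atBot Filter.atBot :=
        Filter.tendsto_atBot_add_const_left _ _ Filter.tendsto_id
      refine Filter.tendsto_atBot_mono' _ ?_ h1
      filter_upwards [Filter.eventually_le_atBot (-l j)] with s hs
      have hs' : l j + s ≤ 0 := by linarith
      simp [R, min_eq_right hs', hT0 s hs']
  let e : ℝ ≃o ℝ := hR.orderIsoOfSurjective R hsurj
  have he : ∀ z, R (e.symm z) = z := fun z => e.apply_symm_apply z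
  refine ⟨e.symm, e.symm.continuous, fun x hx => ?_⟩
  have h1 := he x
  rcases le_or_gt 0 (l j + e.symm x) with h2 | h2
  · simpa only [R, min_eq_left h2, add_zero] using h1
  · simp only [R, hT0 _ h2.le, min_eq_right h2.le] at h1
    linarith

/-- The water-filling allocation satisfies the KKT conditions with multiplier `exp (-σ x)`. Summing
the classwise tangent inequalities against an optimal policy at `y` gives the subgradient bound; at
`x` only feasibility of the allocation is needed. -/
theorem exists_isMarginalDecrease_optimalMissedRate (c : C) :
    ∃ f, IsMarginalDecrease (G.optimalMissedRate c) f := by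
  have hne : Nonempty (Fin M) := ⟨⟨0, G.classes_pos⟩⟩
  have ha := G.availability_pos c
  have hg := G.popularity_pos c
  have hga : ∀ i, 0 < G.popularity c i * G.availability c i := fun i => mul_pos (hg i) (ha i)
  obtain ⟨σ, hσ, hsum⟩ := exists_waterFilling
    (fun i => Real.log (G.popularity c i * G.availability c i)) (G.availability c) ha
  refine ⟨fun x => Real.exp (-σ x), by fun_prop, fun x => Real.exp_pos _, fun x y hx hy => ?_⟩
  set w : Fin M → ℝ := fun i =>
    max 0 ((Real.log (G.popularity c i * G.availability c i) + σ x) / G.availability c i) with hw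
  have hw0 : ∀ i, 0 ≤ w i := fun i => le_max_left _ _
  have hws : ∑ i, w i = x := hsum x hx
  obtain ⟨u, hu⟩ : ∃ u : stdSimplex ℝ (Fin M), ∀ i, x * u.1 i = w i := by
    rcases hx.eq_or_lt with rfl | hx
    · refine ⟨⟨_, single_mem_stdSimplex ℝ (⟨0, G.classes_pos⟩ : Fin M)⟩, fun i => ?_⟩
      rw [zero_mul, ((Finset.sum_eq_zero_iff_of_nonneg fun i _ => hw0 i).1 hws) i
        (Finset.mem_univ i)]
    · refine ⟨⟨fun i => w i / x, fun i => div_nonneg (hw0 i) hx.le, ?_⟩, fun i => ?_⟩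
      · rw [← Finset.sum_div, hws, div_self hx.ne']
      · exact mul_div_cancel₀ _ hx.ne'
  obtain ⟨v, hv, -⟩ := G.exists_optimal_policy c y
  obtain ⟨u', hu', hmin⟩ := G.exists_optimal_policy c x
  have hle : G.optimalMissedRate c x ≤ G.missedRate c u x := hu'.le.trans (hmin u)
  rw [hv]
  have hvs : ∑ i, y * v.1 i = y := by rw [← Finset.mul_sum, v.2.2, mul_one]
  suffices h : G.missedRate c u x - Real.exp (-σ x) * (y - x) ≤ G.missedRate c v y by linarith
  rw [← hvs]
  nth_rw 3 [← hws]
  rw [← Finset.sum_sub_distrib, Finset.mul_sum]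
  unfold missedRate
  rw [hvs, ← Finset.sum_sub_distrib]
  refine Finset.sum_le_sum fun i _ => ?_
  have h1 := exp_subgradient (a := G.availability c i) (v := w i) (w := y * v.1 i) (hg i).le
  rw [mul_assoc, mul_assoc, hu i]
  refine le_trans ?_ h1
  have hexp : Real.exp (Real.log (G.popularity c i * G.availability c i)) =
    G.popularity c i * G.availability c i := Real.exp_log (hga i)
  -- Complementary slackness: marginals equal the multiplier on filled classes and are at most it on
  -- empty ones, where the increment is nonnegative.
  have h2 : G.popularity c i * G.availability c i * Real.exp (-(G.availability c i * w i)) *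
      (y * v.1 i - w i) ≤ Real.exp (-σ x) * (y * v.1 i - w i) := by
    have ha' := ha i
    nth_rw 1 [← hexp]
    rw [← Real.exp_add]
    rcases le_total ((Real.log (G.popularity c i * G.availability c i) + σ x) /
      G.availability c i) 0 with h3 | h3
    · have hwi : w i = 0 := max_eq_left h3
      rw [hwi]
      refine mul_le_mul_of_nonneg_right (Real.exp_le_exp.2 ?_) ?_
      · have := (div_le_iff₀ ha').1 h3
        linarith
      · linarith [mul_nonneg hy (v.2.1 i)]
    · have hwi : w i = _ := max_eq_right h3
      rw [hwi, mul_div_cancel₀ _ ha'.ne']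
      ring_nf
      exact le_rfl
  linarith

theorem exists_isMarginalDecrease_effectiveMissedRate (c : C) :
    ∃ f, IsMarginalDecrease (G.effectiveMissedRate c) f := by
  unfold effectiveMissedRate
  cases G.kind c with
  | rateOptimizer u => exact ⟨_, G.isMarginalDecrease_missedRate c u⟩
  | simultaneousOptimizer => exact G.exists_isMarginalDecrease_optimalMissedRate c

/-! ### Existence and uniqueness of the equilibrium -/

variable [Fintype C] [DecidableEq C]

theorem isNashEquilibrium_iff {f : C → ℝ → ℝ}
    (hf : ∀ c, IsMarginalDecrease (G.effectiveMissedRate c) (f c)) {b : C → ℝ}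
    (hb : ∀ c, b c ∈ Set.Icc 0 (G.maxRate c)) :
    G.IsNashEquilibrium b ↔ ∀ c, IsStationaryShare (f c) (G.price c) (G.maxRate c)
      (∑ v, b v + G.reserved) (G.share b c) := by
  unfold IsNashEquilibrium
  rw [and_iff_right hb]
  refine forall_congr' fun c => ?_
  set s := ∑ v ∈ Finset.univ \ {c}, b v + G.reserved with hs
  have hs0 : 0 < s := add_pos_of_nonneg_of_pos (Finset.sum_nonneg fun v _ => (hb v).1)
    G.reserved_pos
  have hsum : ∀ y, ∑ v, Function.update b c y v + G.reserved = y + s := fun y => by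
    rw [Finset.sum_update_of_mem (Finset.mem_univ c), hs, add_assoc]
  have hsumb : ∑ v, b v + G.reserved = b c + s := by
    simpa only [Function.update_eq_self] using hsum (b c)
  unfold cost share
  rw [hsumb]
  simp only [hsum, Function.update_self]
  exact bestResponse_iff_isStationaryShare (hf c) hs0 (hb c)

theorem existsUnique_isNashEquilibrium : ∃! b : C → ℝ, G.IsNashEquilibrium b := by
  choose f hf using G.exists_isMarginalDecrease_effectiveMissedRate
  have hδ := G.reserved_pos
  have htotal : ∀ b : C → ℝ, G.IsNashEquilibrium b → 0 < ∑ v, b v + G.reserved := fun b hb =>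
    add_pos_of_nonneg_of_pos (Finset.sum_nonneg fun v _ => (hb.1 v).1) hδ
  have hsumshare : ∀ b : C → ℝ, 0 < ∑ v, b v + G.reserved →
      ∑ c, G.share b c = 1 - G.reserved / (∑ v, b v + G.reserved) := fun b hb => by
    unfold share
    rw [← Finset.sum_div]
    field_simp
    ring
  have hanti : ∀ b b' : C → ℝ, G.IsNashEquilibrium b → G.IsNashEquilibrium b' →
      ∑ v, b v + G.reserved ≤ ∑ v, b' v + G.reserved → ∀ c, G.share b' c ≤ G.share b c :=
    fun b b' hb hb' hle c =>
      IsStationaryShare.anti (hf c) (G.price_nonneg c) (htotal b hb) hle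
        ((G.isNashEquilibrium_iff hf hb.1).1 hb c) ((G.isNashEquilibrium_iff hf hb'.1).1 hb' c)
  have htotal_le : ∀ b b' : C → ℝ, G.IsNashEquilibrium b → G.IsNashEquilibrium b' →
      ∑ v, b v + G.reserved ≤ ∑ v, b' v + G.reserved := fun b b' hb hb' => by
    by_contra! hlt
    have h1 := Finset.sum_le_sum fun c (_ : c ∈ Finset.univ) => hanti b' b hb' hb hlt.le c
    rw [hsumshare b (htotal b hb), hsumshare b' (htotal b' hb')] at h1
    have h2 := div_lt_div_of_pos_left hδ (htotal b' hb') hlt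
    linarith
  have hunique : ∀ b b' : C → ℝ, G.IsNashEquilibrium b → G.IsNashEquilibrium b' → b = b' :=
    fun b b' hb hb' => by
      have heq := le_antisymm (htotal_le b b' hb hb') (htotal_le b' b hb' hb)
      funext c
      have h1 := le_antisymm (hanti b' b hb' hb heq.ge c) (hanti b b' hb hb' heq.le c)
      unfold share at h1
      rw [← heq] at h1
      exact (div_left_inj' (htotal b hb).ne').1 h1
  choose X hXc hX using fun c =>
    exists_continuousOn_stationaryShare (hf c) (G.price_nonneg c) (G.maxRate_nonneg c)
  have hB : 0 ≤ ∑ c, G.maxRate c := Finset.sum_nonneg fun c _ => G.maxRate_nonneg c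
  -- Sign change: rates are nonnegative at the left end, and at most `∑ c, G.maxRate c` in total at
  -- the right end.
  obtain ⟨S, ⟨hS, -⟩, hroot⟩ : ∃ S ∈ Set.Icc G.reserved (G.reserved + ∑ c, G.maxRate c),
      ∑ c, X c S * S + G.reserved - S = 0 := by
    refine intermediate_value_Icc' (f := fun S => ∑ c, X c S * S + G.reserved - S)
      (by linarith) ?_ ⟨?_, ?_⟩
    · have hsub : Set.Icc G.reserved (G.reserved + ∑ c, G.maxRate c) ⊆ Set.Ioi 0 :=
        fun S hS => hδ.trans_le hS.1
      refine ContinuousOn.sub (ContinuousOn.add (continuousOn_finsetSum _ fun c _ => ?_)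
        continuousOn_const) continuousOn_id
      exact ((hXc c).mono hsub).mul continuousOn_id
    · have := Finset.sum_le_sum fun c (_ : c ∈ Finset.univ) =>
        (hX c (G.reserved + ∑ c, G.maxRate c) (by linarith)).mul_le
      linarith
    · have := Finset.sum_nonneg fun c (_ : c ∈ Finset.univ) =>
        mul_nonneg (hX c G.reserved hδ).nonneg hδ.le
      linarith
  have hS0 : 0 < S := hδ.trans_le hS
  have hsum : ∑ c, X c S * S + G.reserved = S := by linarith
  have hNash : G.IsNashEquilibrium fun c => X c S * S := by
    refine (G.isNashEquilibrium_iff hf fun c =>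
      ⟨mul_nonneg (hX c S hS0).nonneg hS0.le, (hX c S hS0).mul_le⟩).2 fun c => ?_
    unfold share
    rw [hsum, mul_div_cancel_right₀ _ hS0.ne']
    exact hX c S hS0
  exact ⟨_, hNash, fun b hb => hunique b _ hb hNash⟩

end CachingGame

theorem mainTheorem1 {C : Type*} [Fintype C] [DecidableEq C] {M : ℕ} (G : CachingGame C M) :
    ∃! b : C → ℝ, G.IsNashEquilibrium b :=
  G.existsUnique_isNashEquilibrium
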